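/- Model. A typical vehicle sits at the origin. Macro base stations (MBSs) form a homogeneous Poisson point process in the plane of density $\lambda_m>0$. Independently of them, the small base stations (SBSs) on the vehicle's road, a line through the origin, form a homogeneous one-dimensional Poisson point process of density $\lambda_s>0$. Each MBS (resp. SBS) carries an independent log-normal shadowing gain $\chi_M$ (resp. $\chi_S$), with $10\log_{10}\chi_i\sim N(\omega_i,\delta_i^2)$, and is displaced from its location $x$ to $\chi_i^{-1/\alpha_i}x$, where $\alpha_M,\alpha_S>0$ are the path-loss exponents. Put $\lambda_M=\mathbb E[\chi_M^{2/\alpha_M}]\lambda_m$ and $\lambda_S=\mathbb E[\chi_S^{1/\alpha_S}]\lambda_s$, and let $X_M$, $X_S$ be the distances from the origin to the nearest displaced MBS and SBS. Let the transmit powers $P_M,P_S,P_V$ (MBS, SBS, vehicle) and the antenna gains $G_M,G_{S,0},G_{V,0},G_{V,1}$ be positive, and put $$A_{M,S}=\frac{P_MG_M}{P_SG_{S,0}},\quad B_{M,S}=\frac{P_VG_{V,1}}{P_VG_{V,0}},\quad A_{S,M}=\frac1{A_{M,S}},\quad B_{S,M}=\frac1{B_{M,S}},$$ and assume $A_{M,S}>B_{M,S}$.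 In the downlink the vehicle associates with the MBS if $P_MG_MX_M^{-\alpha_M}>P_SG_{S,0}X_S^{-\alpha_S}$ and with the SBS otherwise; in the uplink it associates with the MBS if $P_VG_{V,1}X_M^{-\alpha_M}>P_VG_{V,0}X_S^{-\alpha_S}$ and with the SBS otherwise. Case 2 is the event that it associates with the SBS in the uplink and with the MBS in the downlink. Lemma. $X_M$ and $X_S$ have probability density functions $f_{X_M}(x)=2\pi\lambda_Mx\,e^{-\lambda_M\pi x^2}$ and $f_{X_S}(x)=2\lambda_Se^{-2\lambda_Sx}$ for $x\ge0$ (and $0$ for $x<0$), $\Pr(\text{Case 2})>0$, and conditionally on Case 2 the distances $X_M$ (to the serving downlink MBS) and $X_S$ (to the serving uplink SBS) have the probability density functions, for $x\ge0$ (and $0$ for $x<0$), $$f_{X_M\mid\text{Case 2}}(x)=\frac{\left[\exp\left(-2\lambda_SA_{S,M}^{1/\alpha_S}x^{\alpha_M/\alpha_S}\right)-\exp\left(-2\lambda_SB_{S,M}^{1/\alpha_S}x^{\alpha_M/\alpha_S}\right)\right]f_{X_M}(x)}{\Pr(\text{Case 2})},$$ $$f_{X_S\mid\text{Case 2}}(x)=\frac{\left[\exp\left(-\lambda_M\pi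 B_{M,S}^{2/\alpha_M}x^{2\alpha_S/\alpha_M}\right)-\exp\left(-\lambda_M\pi A_{M,S}^{2/\alpha_M}x^{2\alpha_S/\alpha_M}\right)\right]f_{X_S}(x)}{\Pr(\text{Case 2})}.$$ -/

import Mathlib

open MeasureTheory ProbabilityTheory
open scoped NNReal ENNReal

noncomputable section

/-- The number of points of the configuration `Φ ω` that lie in `B`. -/
def pointCount {Ω E : Type*} (Φ : Ω → Set E) (B : Set E) (ω : Ω) : ℕ∞ :=
  (Φ ω ∩ B).encard

/-- `Φ` is a (simple) Poisson point process with intensity measure `Λ` under `P`: counts are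
random variables, the count of a set of finite intensity is Poisson, and the counts of disjoint
sets are independent. -/
structure IsPoissonPointProcess {Ω E : Type*} [MeasurableSpace Ω] [MeasurableSpace E]
    (P : Measure Ω) (Φ : Ω → Set E) (Λ : Measure E) : Prop where
  measurable_count : ∀ B : Set E, MeasurableSet B → Measurable (pointCount Φ B)
  count_law : ∀ B : Set E, MeasurableSet B → Λ B ≠ ∞ → ∀ k : ℕ,
    P {ω | pointCount Φ B ω = k} =
      ENNReal.ofReal (Real.exp (-(Λ B).toReal) * (Λ B).toReal ^ k / (k.factorial : ℝ))
  indep : ∀ (n : ℕ) (B : Fin n → Set E), (∀ i, MeasurableSet (B i)) →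
    Pairwise (fun i j => Disjoint (B i) (B j)) → iIndepFun (fun i => pointCount Φ (B i)) P

/-- The sigma-algebra generated by a point process, that is, by all its counts. -/
@[reducible] def pointSigma {Ω E : Type*} [MeasurableSpace E] (Φ : Ω → Set E) : MeasurableSpace Ω :=
  ⨆ B : {B : Set E // MeasurableSet B}, MeasurableSpace.comap (pointCount Φ B.1) inferInstance

/-- Two point processes on the same probability space are independent. -/
def IndepPointProcesses {Ω E F : Type*} [MeasurableSpace Ω] [MeasurableSpace E]
    [MeasurableSpace F] (P : Measure Ω) (Φ : Ω → Set E) (Ψ : Ω → Set F) : Prop :=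
  Indep (pointSigma Φ) (pointSigma Ψ) P

/-- The log-normal law of a shadowing gain `χ` with `10 log₁₀ χ ∼ N(w, v)` (`v` is the variance;
`w = 0`, `v = 0` means no shadowing). -/
def shadowingLaw (w : ℝ) (v : ℝ≥0) : Measure ℝ :=
  (gaussianReal w v).map (fun z : ℝ => (10 : ℝ) ^ (z / 10))

/-- A homogeneous Poisson point process of density `lam` on `E` whose points carry independent
shadowing gains with law `shadowingLaw w v`; a marked point is a pair (location, gain). -/
def IsShadowedPPP {Ω E : Type*} [MeasurableSpace Ω] [MeasureSpace E]
    (P : Measure Ω) (Φ : Ω → Set (E × ℝ)) (lam w : ℝ) (v : ℝ≥0) : Prop :=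
  IsPoissonPointProcess P Φ
    ((ENNReal.ofReal lam • (volume : Measure E)).prod (shadowingLaw w v))

/-- The random displacement: a point at `x` with gain `χ` is moved to `χ ^ (-1/α) • x`, so that
the received power `χ ‖x‖ ^ (-α)` equals `‖y‖ ^ (-α)` at the new location `y`. -/
def displacedPoints {E : Type*} [SMul ℝ E] (α : ℝ) (Φ : Set (E × ℝ)) : Set E :=
  (fun p : E × ℝ => p.2 ^ (-1 / α) • p.1) '' Φ

/-- The intensity `E[χ ^ (d/α)] lam` of the displaced points of a homogeneous process of
density `lam` in dimension `d`. -/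
def displacedIntensity (d : ℕ) (α lam w : ℝ) (v : ℝ≥0) : ℝ :=
  (∫ χ, χ ^ ((d : ℝ) / α) ∂(shadowingLaw w v)) * lam

/-- The distance from the typical vehicle (at the origin) to the nearest displaced point. -/
def nearestDist {Ω E : Type*} [NormedAddCommGroup E] [NormedSpace ℝ E]
    (α : ℝ) (Φ : Ω → Set (E × ℝ)) (ω : Ω) : ℝ :=
  Metric.infDist (0 : E) (displacedPoints α (Φ ω))

/-- The vehicle compares the nearest MBS at distance `xM`, with transmit power times gain `kM`,
with the nearest SBS at distance `xS`, with transmit power times gain `kS`: it associates with the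
MBS exactly if the (averaged) power of that link is strictly larger, otherwise with the SBS. -/
def AssocMBS (kM αM xM kS αS xS : ℝ) : Prop :=
  kS * xS ^ (-αS) < kM * xM ^ (-αM)

/-- The event of Case 2: the vehicle associates with the MBS in the downlink (where base stations
transmit, with powers `PM`, `PS`) and with the SBS in the uplink (where the vehicle transmits,
with power `PV`). -/
def case2 {Ω : Type*} (PM PS PV GM GS0 GV0 GV1 αM αS : ℝ) (XM XS : Ω → ℝ) : Set Ω :=
  {ω | AssocMBS (PM * GM) αM (XM ω) (PS * GS0) αS (XS ω) ∧
    ¬ AssocMBS (PV * GV1) αM (XM ω) (PV * GV0) αS (XS ω)}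

/-- The density `2 π lamM x exp(-lamM π x²)` on `[0, ∞)`. -/
def pdfM (lamM x : ℝ) : ℝ :=
  if 0 ≤ x then 2 * Real.pi * lamM * x * Real.exp (-(lamM * Real.pi * x ^ 2)) else 0

/-- The density `2 lamS exp(-2 lamS x)` on `[0, ∞)`. -/
def pdfS (lamS x : ℝ) : ℝ :=
  if 0 ≤ x then 2 * lamS * Real.exp (-(2 * lamS * x)) else 0

/-- The real random variable `X` has, under `Q`, the probability density function `f`. -/
def HasDensity {Ω : Type*} [MeasurableSpace Ω] (X : Ω → ℝ) (Q : Measure Ω) (f : ℝ → ℝ) : Prop :=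
  HasPDF X Q volume ∧ (∀ x, 0 ≤ f x) ∧
    pdf X Q volume =ᵐ[volume] fun x => ENNReal.ofReal (f x)

end

/-! ### Moments of the log-normal gain -/

section Shadowing

/-! No displacement theorem is needed. The displaced points within `r` of the origin come from the
marked points with `‖x‖ < χ ^ (1/α) * r`, a region whose intensity Fubini gives as `κ E[χ ^ (d/α)]
lam r ^ d`. The void probability is then the tail `exp (-c r ^ d)` of the nearest distance
(`IsShadowedPPP.measure_le_nearestDist`), with `c = π lamM`, `d = 2` in the plane and `c = 2 lamS`,
`d = 1` on the line. Both densities are instances of `radialPDF`.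

Each distance is measurable for the sigma-algebra of its own process, so the two are independent.
Case 2 says that `(XM, XS)` lies in a planar region `R`. Fixing one coordinate, the two association
inequalities confine the other, up to null sets, to an interval, whose probability is a difference
of two tails: the bracket in the formula. Multiplying by the density of the fixed coordinate and
dividing by the probability of Case 2 gives the conditional density (`hasDensity_cond_of_indepFun`).
That probability is positive because `BMS < AMS` makes the bracket positive for every `x > 0`. -/

instance isProbabilityMeasure_shadowingLaw (w : ℝ) (v : ℝ≥0) :
    IsProbabilityMeasure (shadowingLaw w v) := by
  unfold shadowingLaw
  exact Measure.isProbabilityMeasure_map (by fun_prop)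

theorem ae_shadowingLaw_pos (w : ℝ) (v : ℝ≥0) : ∀ᵐ χ ∂(shadowingLaw w v), 0 < χ := by
  unfold shadowingLaw
  rw [ae_map_iff (by fun_prop) measurableSet_Ioi]
  exact Filter.Eventually.of_forall fun z => by positivity

/-- Turns moments of the gain into values of the Gaussian moment generating function, which are
finite and positive. -/
theorem ten_rpow_div_rpow (z t : ℝ) :
    ((10 : ℝ) ^ (z / 10)) ^ t = Real.exp ((Real.log 10 * t / 10) * z) := by
  rw [← Real.rpow_mul (by norm_num), Real.rpow_def_of_pos (by norm_num)]
  congr 1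
  ring

theorem integrable_rpow_shadowingLaw (w : ℝ) (v : ℝ≥0) (t : ℝ) :
    Integrable (fun χ : ℝ => χ ^ t) (shadowingLaw w v) := by
  unfold shadowingLaw
  rw [integrable_map_measure (by fun_prop) (by fun_prop)]
  simpa only [Function.comp_def, ten_rpow_div_rpow] using
    integrable_exp_mul_gaussianReal (μ := w) (v := v) (Real.log 10 * t / 10)

theorem integral_rpow_shadowingLaw_pos (w : ℝ) (v : ℝ≥0) (t : ℝ) :
    0 < ∫ χ, χ ^ t ∂(shadowingLaw w v) := by
  unfold shadowingLaw
  rw [integral_map (by fun_prop) (by fun_prop)]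
  simp only [ten_rpow_div_rpow]
  exact integral_exp_pos (integrable_exp_mul_gaussianReal _)

theorem displacedIntensity_pos {d : ℕ} {α lam w : ℝ} {v : ℝ≥0} (hlam : 0 < lam) :
    0 < displacedIntensity d α lam w v :=
  mul_pos (integral_rpow_shadowingLaw_pos w v _) hlam

end Shadowing

/-! ### Measurability with respect to the process -/

section PointProcess

theorem measurable_pointCount_pointSigma {Ω E : Type*} [MeasurableSpace E] (Φ : Ω → Set E) {B : Set E}
    (hB : MeasurableSet B) : Measurable[pointSigma Φ] (pointCount Φ B) := by
  rw [measurable_iff_comap_le]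
  exact le_iSup (fun B : {B : Set E // MeasurableSet B} =>
    MeasurableSpace.comap (pointCount Φ B.1) inferInstance) ⟨B, hB⟩

theorem IsPoissonPointProcess.pointSigma_le {Ω E : Type*} [MeasurableSpace Ω] [MeasurableSpace E]
    {P : Measure Ω} {Φ : Ω → Set E}
    {Λ : Measure E} (hΦ : IsPoissonPointProcess P Φ Λ) : pointSigma Φ ≤ ‹MeasurableSpace Ω› :=
  iSup_le fun B => (hΦ.measurable_count B.1 B.2).comap_le

end PointProcess

/-! ### Law of the nearest displaced point -/

section Displacement

/-- The marked points whose displaced location is at distance less than `r` from the origin. -/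
def nearMarks (E : Type*) [NormedAddCommGroup E] [NormedSpace ℝ E] (α r : ℝ) : Set (E × ℝ) :=
  {p | ‖p.2 ^ (-1 / α) • p.1‖ < r}

variable {Ω E : Type*} [NormedAddCommGroup E] [NormedSpace ℝ E]

theorem measurableSet_nearMarks [MeasurableSpace E] [BorelSpace E] [SecondCountableTopology E]
    (α r : ℝ) : MeasurableSet (nearMarks E α r) :=
  measurableSet_lt (by fun_prop) measurable_const

theorem nearMarks_section {α χ : ℝ} (hχ : 0 < χ) (r : ℝ) :
    (fun x : E => (x, χ)) ⁻¹' nearMarks E α r = Metric.ball 0 (χ ^ (1 / α) * r) := by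
  ext x
  have h : 0 < χ ^ (1 / α) := by positivity
  have h' : χ ^ (-1 / α) = (χ ^ (1 / α))⁻¹ := by
    rw [← Real.rpow_neg hχ.le]
    congr 1
    ring
  simp only [nearMarks, Set.mem_preimage, Set.mem_ofPred_eq, norm_smul, h', norm_inv,
    Real.norm_of_nonneg h.le, mem_ball_zero_iff]
  rw [inv_mul_lt_iff₀ h]

/-- Fubini with the gain outermost: each section is a ball of radius `χ ^ (1/α) * r`. Abstract `κ`
and `d` serve the plane and the line at once. -/
theorem intensity_nearMarks [MeasureSpace E] [BorelSpace E] [SecondCountableTopology E]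
    [SFinite (volume : Measure E)] {κ : ℝ} {d : ℕ} (hκ : 0 ≤ κ)
    (hvol : ∀ ρ : ℝ, 0 ≤ ρ → volume (Metric.ball (0 : E) ρ) = ENNReal.ofReal (κ * ρ ^ d))
    (α w : ℝ) (v : ℝ≥0) {lam r : ℝ} (hlam : 0 ≤ lam) (hr : 0 ≤ r) :
    ((ENNReal.ofReal lam • (volume : Measure E)).prod (shadowingLaw w v)) (nearMarks E α r) =
      ENNReal.ofReal (κ * displacedIntensity d α lam w v * r ^ d) := by
  rw [Measure.prod_apply_symm (measurableSet_nearMarks α r)]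
  have h : ∀ᵐ χ ∂(shadowingLaw w v),
      (ENNReal.ofReal lam • (volume : Measure E)) ((fun x : E => (x, χ)) ⁻¹' nearMarks E α r) =
        ENNReal.ofReal (κ * r ^ d * lam * χ ^ ((d : ℝ) / α)) := by
    filter_upwards [ae_shadowingLaw_pos w v] with χ hχ
    rw [nearMarks_section hχ, Measure.smul_apply, hvol _ (by positivity), smul_eq_mul,
      ← ENNReal.ofReal_mul hlam, mul_pow, ← Real.rpow_mul_natCast hχ.le]
    congr 1
    rw [show 1 / α * (d : ℝ) = (d : ℝ) / α by ring]
    ring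
  rw [lintegral_congr_ae h, ← ofReal_integral_eq_lintegral_ofReal
    ((integrable_rpow_shadowingLaw w v _).const_mul _)
    (by
      filter_upwards [ae_shadowingLaw_pos w v] with χ hχ
      simp only [Pi.zero_apply]
      positivity), integral_const_mul, displacedIntensity]
  congr 1
  ring

/-- The first alternative is due to the default `Metric.infDist _ ∅ = 0`. -/
theorem nearestDist_lt_iff (α : ℝ) (Φ : Ω → Set (E × ℝ)) (ω : Ω) {r : ℝ} (hr : 0 < r) :
    nearestDist α Φ ω < r ↔
      pointCount Φ Set.univ ω = 0 ∨ pointCount Φ (nearMarks E α r) ω ≠ 0 := by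
  have hne : pointCount Φ (nearMarks E α r) ω ≠ 0 ↔
      ∃ p ∈ Φ ω, ‖p.2 ^ (-1 / α) • p.1‖ < r := by
    rw [pointCount, Set.encard_ne_zero]
    rfl
  have h0 : pointCount Φ Set.univ ω = 0 ↔ Φ ω = ∅ := by
    rw [pointCount, Set.encard_eq_zero, Set.inter_univ]
  rw [hne, h0, nearestDist, displacedPoints]
  rcases (Φ ω).eq_empty_or_nonempty with h | h
  · simp [h, hr]
  · rw [Metric.infDist_lt_iff (h.image _), Set.exists_mem_image]
    simp [h.ne_empty]

theorem measurable_nearestDist_pointSigma [MeasurableSpace E] [BorelSpace E]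
    [SecondCountableTopology E] (α : ℝ) (Φ : Ω → Set (E × ℝ)) :
    Measurable[pointSigma Φ] (nearestDist α Φ) := by
  refine @measurable_of_Iio ℝ Ω _ _ _ (pointSigma Φ) _ _ _ _ fun r => ?_
  rcases le_or_gt r 0 with hr | hr
  · have : nearestDist α Φ ⁻¹' Set.Iio r = ∅ := by
      ext ω
      simp only [Set.mem_preimage, Set.mem_Iio, Set.mem_empty_iff_false, iff_false, not_lt]
      exact hr.trans Metric.infDist_nonneg
    rw [this]
    exact @MeasurableSet.empty _ (pointSigma Φ)
  · have : nearestDist α Φ ⁻¹' Set.Iio r = pointCount Φ Set.univ ⁻¹' {0} ∪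
        pointCount Φ (nearMarks E α r) ⁻¹' {0}ᶜ := by
      ext ω
      simpa using nearestDist_lt_iff α Φ ω hr
    rw [this]
    exact @MeasurableSet.union _ (pointSigma Φ) _ _
      (measurable_pointCount_pointSigma Φ MeasurableSet.univ (measurableSet_singleton _))
      (measurable_pointCount_pointSigma Φ (measurableSet_nearMarks α r)
        (measurableSet_singleton _).compl)

theorem IsShadowedPPP.measure_le_nearestDist [MeasurableSpace Ω] [MeasureSpace E] [BorelSpace E]
    [SecondCountableTopology E] [SFinite (volume : Measure E)] {P : Measure Ω}
    {Φ : Ω → Set (E × ℝ)} {α lam w κ : ℝ} {v : ℝ≥0} {d : ℕ}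
    (hΦ : IsShadowedPPP P Φ lam w v) (hlam : 0 < lam) (hκ : 0 < κ) (hd : d ≠ 0)
    (hvol : ∀ ρ : ℝ, 0 ≤ ρ → volume (Metric.ball (0 : E) ρ) = ENNReal.ofReal (κ * ρ ^ d))
    {r : ℝ} (hr : 0 < r) :
    P {ω | r ≤ nearestDist α Φ ω} =
      ENNReal.ofReal (Real.exp (-(κ * displacedIntensity d α lam w v * r ^ d))) := by
  have hI : 0 < κ * displacedIntensity d α lam w v := mul_pos hκ (displacedIntensity_pos hlam)
  have hvoid : ∀ s : ℝ, 0 < s → P {ω | pointCount Φ (nearMarks E α s) ω = 0} =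
      ENNReal.ofReal (Real.exp (-(κ * displacedIntensity d α lam w v * s ^ d))) := by
    intro s hs
    have hΛ := intensity_nearMarks hκ.le hvol α w v hlam.le hs.le
    have h := hΦ.count_law _ (measurableSet_nearMarks α s) (by rw [hΛ]; finiteness) 0
    rw [hΛ, ENNReal.toReal_ofReal (by positivity)] at h
    simpa using h
  -- An empty configuration is void near the origin for every `s`, and those probabilities tend to
  -- `0`. So the default distance is almost surely never used.
  have hempty : P {ω | pointCount Φ Set.univ ω = 0} = 0 := by
    have hlim : Filter.Tendsto (fun s : ℝ => ENNReal.ofReal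
        (Real.exp (-(κ * displacedIntensity d α lam w v * s ^ d)))) Filter.atTop (nhds 0) := by
      rw [← ENNReal.ofReal_zero]
      refine ENNReal.tendsto_ofReal (Real.tendsto_exp_neg_atTop_nhds_zero.comp ?_)
      exact (Filter.tendsto_pow_atTop hd).const_mul_atTop hI
    refine le_antisymm (ge_of_tendsto hlim ?_) zero_le
    filter_upwards [Filter.eventually_gt_atTop 0] with s hs
    rw [← hvoid s hs]
    refine measure_mono fun ω hω => ?_
    have h : pointCount Φ (nearMarks E α s) ω ≤ pointCount Φ Set.univ ω :=
      Set.encard_le_encard (Set.inter_subset_inter_right _ (Set.subset_univ _))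
    exact nonpos_iff_eq_zero.1 (h.trans_eq hω)
  rw [← hvoid r hr]
  refine measure_congr ?_
  filter_upwards [measure_eq_zero_iff_ae_notMem.1 hempty] with ω hω
  have h := (nearestDist_lt_iff α Φ ω hr).not
  simp only [not_lt, not_or, not_not] at h
  exact propext (h.trans ⟨fun h => h.2, fun h => ⟨hω, h⟩⟩)

end Displacement

/-! ### The common form of both densities -/

section RadialDensity

/-- The density `c d x ^ (d - 1) exp(-c x ^ d)` on `[0, ∞)` of the distance from the origin to the
nearest point of a process with `c r ^ d` expected points within distance `r`. -/
noncomputable def radialPDF (c : ℝ) (d : ℕ) (x : ℝ) : ℝ :=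
  if 0 ≤ x then c * (d * x ^ (d - 1)) * Real.exp (-(c * x ^ d)) else 0

theorem radialPDF_nonneg {c : ℝ} (hc : 0 ≤ c) (d : ℕ) (x : ℝ) : 0 ≤ radialPDF c d x := by
  unfold radialPDF
  split_ifs
  · positivity
  · exact le_rfl

theorem radialPDF_pos {c : ℝ} (hc : 0 < c) {d : ℕ} (hd : d ≠ 0) {x : ℝ} (hx : 0 < x) :
    0 < radialPDF c d x := by
  rw [radialPDF, if_pos hx.le]
  positivity

theorem radialPDF_of_neg {c : ℝ} {d : ℕ} {x : ℝ} (hx : x < 0) : radialPDF c d x = 0 :=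
  if_neg hx.not_ge

theorem measurable_radialPDF (c : ℝ) (d : ℕ) : Measurable (radialPDF c d) :=
  Measurable.ite measurableSet_Ici (by fun_prop) measurable_const

theorem pdfM_eq_radialPDF (lam : ℝ) : pdfM lam = radialPDF (Real.pi * lam) 2 := by
  ext x
  unfold pdfM radialPDF
  split_ifs
  · rw [mul_comm lam Real.pi]
    norm_num
    ring
  · rfl

theorem pdfS_eq_radialPDF (lam : ℝ) : pdfS lam = radialPDF (2 * lam) 1 := by
  ext x
  simp [pdfS, radialPDF]

/-- The antiderivative is `-exp (-c x ^ d)`; `max r 0` appears because the density vanishes on the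
negatives. -/
theorem withDensity_radialPDF_Ici {c : ℝ} (hc : 0 < c) {d : ℕ} (hd : d ≠ 0) (r : ℝ) :
    volume.withDensity (fun x => ENNReal.ofReal (radialPDF c d x)) (Set.Ici r) =
      ENNReal.ofReal (Real.exp (-(c * (max r 0) ^ d))) := by
  set f : ℝ → ℝ := fun x => c * (d * x ^ (d - 1)) * Real.exp (-(c * x ^ d)) with hf
  have hind : (fun x => ENNReal.ofReal (radialPDF c d x)) =
      (Set.Ici 0).indicator fun x => ENNReal.ofReal (f x) := by
    ext x
    by_cases hx : 0 ≤ x <;> simp [radialPDF, hx, hf]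
  have hderiv : ∀ x ∈ Set.Ici (max r 0),
      HasDerivAt (fun x => -Real.exp (-(c * x ^ d))) (f x) x := by
    intro x _
    refine (((hasDerivAt_pow d x).const_mul c).fun_neg.exp.fun_neg).congr_deriv ?_
    simp only [hf]
    ring
  have hpos : ∀ x ∈ Set.Ioi (max r 0), 0 ≤ f x := by
    intro x hx
    have : 0 < x := (le_max_right r 0).trans_lt hx
    simp only [hf]
    positivity
  have hlim : Filter.Tendsto (fun x : ℝ => -Real.exp (-(c * x ^ d))) Filter.atTop (nhds 0) := by
    rw [← neg_zero]
    exact (Real.tendsto_exp_neg_atTop_nhds_zero.comp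
      ((Filter.tendsto_pow_atTop hd).const_mul_atTop hc)).neg
  rw [withDensity_apply _ measurableSet_Ici, hind, setLIntegral_indicator measurableSet_Ici,
    Set.Ici_inter_Ici, sup_comm, setLIntegral_congr Ioi_ae_eq_Ici.symm,
    ← ofReal_integral_eq_lintegral_ofReal
      (integrableOn_Ioi_deriv_of_nonneg' hderiv hpos hlim)
      ((ae_restrict_iff' measurableSet_Ioi).2 (Filter.Eventually.of_forall hpos)),
    integral_Ioi_of_hasDerivAt_of_nonneg' hderiv hpos hlim]
  simp

theorem map_eq_withDensity_radialPDF {Ω : Type*} [MeasurableSpace Ω] {P : Measure Ω}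
    [IsProbabilityMeasure P] {X : Ω → ℝ} (hX : Measurable X) (hX0 : ∀ ω, 0 ≤ X ω) {c : ℝ}
    (hc : 0 < c) {d : ℕ} (hd : d ≠ 0)
    (h : ∀ r : ℝ, 0 < r → P {ω | r ≤ X ω} = ENNReal.ofReal (Real.exp (-(c * r ^ d)))) :
    P.map X = volume.withDensity fun x => ENNReal.ofReal (radialPDF c d x) := by
  have := Measure.isProbabilityMeasure_map (μ := P) hX.aemeasurable
  refine Measure.ext_of_Ici _ _ fun r => ?_
  rw [withDensity_radialPDF_Ici hc hd, Measure.map_apply hX measurableSet_Ici]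
  rcases le_or_gt r 0 with hr | hr
  · have : X ⁻¹' Set.Ici r = Set.univ := Set.eq_univ_of_forall fun ω => hr.trans (hX0 ω)
    rw [this, max_eq_right hr]
    simp [hd]
  · rw [max_eq_left hr.le, ← h r hr]
    rfl

theorem withDensity_radialPDF_Ico {c : ℝ} (hc : 0 < c) {d : ℕ} (hd : d ≠ 0) {a b : ℝ}
    (ha : 0 ≤ a) (hab : a ≤ b) :
    volume.withDensity (fun x => ENNReal.ofReal (radialPDF c d x)) (Set.Ico a b) =
      ENNReal.ofReal (Real.exp (-(c * a ^ d)) - Real.exp (-(c * b ^ d))) := by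
  rw [← Set.Ici_sdiff_Ici, measure_sdiff (Set.Ici_subset_Ici.2 hab)
    measurableSet_Ici.nullMeasurableSet
    (by rw [withDensity_radialPDF_Ici hc hd]; exact ENNReal.ofReal_ne_top),
    withDensity_radialPDF_Ici hc hd, withDensity_radialPDF_Ici hc hd, max_eq_left ha,
    max_eq_left (ha.trans hab), ENNReal.ofReal_sub _ (Real.exp_nonneg _)]

theorem ae_withDensity_radialPDF_pos (c : ℝ) (d : ℕ) :
    ∀ᵐ x ∂(volume.withDensity fun x => ENNReal.ofReal (radialPDF c d x)), 0 < x := by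
  rw [ae_withDensity_iff (measurable_radialPDF c d).ennreal_ofReal]
  filter_upwards [Measure.ae_ne volume (0 : ℝ)] with x hx hf
  by_contra hneg
  exact hf (by rw [radialPDF_of_neg (lt_of_le_of_ne (not_lt.1 hneg) hx), ENNReal.ofReal_zero])

end RadialDensity

/-! ### Densities conditional on a planar event -/

section Conditioning

variable {Ω : Type*} [MeasurableSpace Ω] {P : Measure Ω}

theorem hasDensity_of_map_eq_withDensity [IsFiniteMeasure P] {X : Ω → ℝ} (hX : AEMeasurable X P)
    {f : ℝ → ℝ} (hf : Measurable f) (hf0 : ∀ x, 0 ≤ f x)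
    (h : P.map X = volume.withDensity fun x => ENNReal.ofReal (f x)) : HasDensity X P f := by
  have hm : AEMeasurable (fun x => ENNReal.ofReal (f x)) volume := hf.ennreal_ofReal.aemeasurable
  have hpdf : HasPDF X P volume := hasPDF_of_map_eq_withDensity hX _ hm h
  exact ⟨hpdf, hf0, (pdf.eq_of_map_eq_withDensity _ hm).1 h⟩

/-- If `X` has density `f` and is independent of `Y`, and `g x` is the probability that `(x, Y)`
lies in `R`, then `g x * f x` is the density of `X` on the event that `(X, Y)` lies in `R`. -/
theorem measure_preimage_inter_of_indepFun [IsProbabilityMeasure P] {X Y : Ω → ℝ}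
    (hX : Measurable X) (hY : Measurable Y) (hXY : IndepFun X Y P) {f g : ℝ → ℝ}
    (hf : Measurable f) (hf0 : ∀ x, 0 ≤ f x) (hfneg : ∀ x < 0, f x = 0)
    (hmap : P.map X = volume.withDensity fun x => ENNReal.ofReal (f x))
    {R : Set (ℝ × ℝ)} (hR : MeasurableSet R)
    (hsec : ∀ x, 0 < x → P.map Y (Prod.mk x ⁻¹' R) = ENNReal.ofReal (g x))
    {T : Set ℝ} (hT : MeasurableSet T) :
    P (X ⁻¹' T ∩ {ω | (X ω, Y ω) ∈ R}) = ∫⁻ x in T, ENNReal.ofReal (g x * f x) := by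
  have hset : X ⁻¹' T ∩ {ω | (X ω, Y ω) ∈ R} =
      (fun ω => (X ω, Y ω)) ⁻¹' (T ×ˢ Set.univ ∩ R) := by
    ext ω
    simp
  have := Measure.isProbabilityMeasure_map (μ := P) hY.aemeasurable
  have hTR : MeasurableSet (T ×ˢ Set.univ ∩ R) := (hT.prod MeasurableSet.univ).inter hR
  rw [hset, ← Measure.map_apply (hX.prodMk hY) hTR,
    hXY.map_prod_eq_prod_map_map hX.aemeasurable hY.aemeasurable, Measure.prod_apply hTR, hmap,
    lintegral_withDensity_eq_lintegral_mul _ hf.ennreal_ofReal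
      (measurable_measure_prodMk_left hTR), ← lintegral_indicator hT]
  refine lintegral_congr_ae ?_
  filter_upwards [Measure.ae_ne volume (0 : ℝ)] with x hx
  rw [Pi.mul_apply]
  by_cases hxT : x ∈ T
  · have hpre : Prod.mk x ⁻¹' (T ×ˢ Set.univ ∩ R) = Prod.mk x ⁻¹' R := by
      ext y
      simp [hxT]
    rw [Set.indicator_of_mem hxT, hpre]
    rcases lt_or_gt_of_ne hx with hx | hx
    · simp [hfneg x hx]
    · rw [hsec x hx, mul_comm, ENNReal.ofReal_mul' (hf0 x)]
  · have hpre : Prod.mk x ⁻¹' (T ×ˢ Set.univ ∩ R) = ∅ := by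
      ext y
      simp [hxT]
    rw [Set.indicator_of_notMem hxT, hpre, measure_empty, mul_zero]

theorem hasDensity_cond_of_indepFun [IsProbabilityMeasure P] {X Y : Ω → ℝ}
    (hX : Measurable X) (hY : Measurable Y) (hXY : IndepFun X Y P) {f g : ℝ → ℝ}
    (hf : Measurable f) (hf0 : ∀ x, 0 ≤ f x) (hfneg : ∀ x < 0, f x = 0)
    (hmap : P.map X = volume.withDensity fun x => ENNReal.ofReal (f x))
    (hg : Measurable g) (hg0 : ∀ x, 0 ≤ x → 0 ≤ g x)
    {R : Set (ℝ × ℝ)} (hR : MeasurableSet R)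
    (hsec : ∀ x, 0 < x → P.map Y (Prod.mk x ⁻¹' R) = ENNReal.ofReal (g x))
    {C : Set Ω} (hC : C = {ω | (X ω, Y ω) ∈ R}) (hC0 : 0 < P.real C) :
    HasDensity X P[|C] (fun x => g x * f x / P.real C) := by
  have hCm : MeasurableSet C := hC ▸ (hX.prodMk hY) hR
  have hgf : ∀ x, 0 ≤ g x * f x := by
    intro x
    rcases lt_or_ge x 0 with hx | hx
    · simp [hfneg x hx]
    · exact mul_nonneg (hg0 x hx) (hf0 x)
  have hm : Measurable fun x => g x * f x := hg.mul hf
  refine hasDensity_of_map_eq_withDensity hX.aemeasurable (hm.div_const _)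
    (fun x => div_nonneg (hgf x) hC0.le) ?_
  ext T hT
  have hPT := measure_preimage_inter_of_indepFun hX hY hXY hf hf0 hfneg hmap hR hsec hT
  rw [← hC] at hPT
  rw [Measure.map_apply hX hT, cond_apply hCm, withDensity_apply _ hT, Set.inter_comm, hPT,
    ← lintegral_const_mul _ hm.ennreal_ofReal]
  refine lintegral_congr fun x => ?_
  rw [div_eq_inv_mul, ENNReal.ofReal_mul (inv_nonneg.2 hC0.le), ENNReal.ofReal_inv_of_pos hC0,
    ofReal_measureReal]

end Conditioning

/-! ### Association as a distance threshold -/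

section Association

theorem assocMBS_iff_lt_right {kM αM x kS αS y : ℝ} (hkM : 0 < kM) (hkS : 0 < kS) (hαS : 0 < αS)
    (hx : 0 < x) (hy : 0 < y) :
    AssocMBS kM αM x kS αS y ↔ (kS / kM) ^ (1 / αS) * x ^ (αM / αS) < y := by
  have h : (kS / kM) ^ (1 / αS) * x ^ (αM / αS) = (kS / kM * x ^ αM) ^ (αS⁻¹) := by
    rw [Real.mul_rpow (by positivity) (by positivity), ← Real.rpow_mul hx.le, one_div,
      div_eq_mul_inv αM]
  rw [h, Real.rpow_inv_lt_iff_of_pos (by positivity) hy.le hαS, AssocMBS, Real.rpow_neg hx.le,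
    Real.rpow_neg hy.le, ← div_eq_mul_inv, ← div_eq_mul_inv,
    div_lt_div_iff₀ (by positivity) (by positivity), div_mul_eq_mul_div, div_lt_iff₀ hkM,
    mul_comm kM]

theorem assocMBS_iff_lt_left {kM αM x kS αS y : ℝ} (hkM : 0 < kM) (hkS : 0 < kS) (hαM : 0 < αM)
    (hx : 0 < x) (hy : 0 < y) :
    AssocMBS kM αM x kS αS y ↔ x < (kM / kS) ^ (1 / αM) * y ^ (αS / αM) := by
  have h : (kM / kS) ^ (1 / αM) * y ^ (αS / αM) = (kM / kS * y ^ αS) ^ (αM⁻¹) := by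
    rw [Real.mul_rpow (by positivity) (by positivity), ← Real.rpow_mul hy.le, one_div,
      div_eq_mul_inv αS]
  rw [h, Real.lt_rpow_inv_iff_of_pos hx.le (by positivity) hαM, AssocMBS, Real.rpow_neg hx.le,
    Real.rpow_neg hy.le, ← div_eq_mul_inv, ← div_eq_mul_inv,
    div_lt_div_iff₀ (by positivity) (by positivity), div_mul_eq_mul_div, lt_div_iff₀ hkS,
    mul_comm kS]

theorem measurableSet_assocMBS (kM αM kS αS : ℝ) :
    MeasurableSet {p : ℝ × ℝ | AssocMBS kM αM p.1 kS αS p.2} :=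
  measurableSet_lt (by fun_prop) (by fun_prop)

end Association

/-! ### The main result -/

theorem lemma5 {Ω : Type*} [MeasurableSpace Ω] (P : Measure Ω) [IsProbabilityMeasure P]
    -- transmit powers, antenna gains, path-loss exponents
    (PM PS PV GM GS0 GV0 GV1 αM αS : ℝ)
    (hPM : 0 < PM) (hPS : 0 < PS) (hPV : 0 < PV) (hGM : 0 < GM) (hGS0 : 0 < GS0)
    (hGV0 : 0 < GV0) (hGV1 : 0 < GV1) (hαM : 0 < αM) (hαS : 0 < αS)
    -- power ratios
    (AMS ASM BMS BSM : ℝ)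
    (hAMS : AMS = (PM * GM) / (PS * GS0)) (hASM : ASM = (PS * GS0) / (PM * GM))
    (hBMS : BMS = (PV * GV1) / (PV * GV0)) (hBSM : BSM = (PV * GV0) / (PV * GV1))
    (hAB : BMS < AMS)
    -- densities before displacement, shadowing parameters, intensities after displacement
    (lamm lams wM wS : ℝ) (vM vS : ℝ≥0) (hlamm : 0 < lamm) (hlams : 0 < lams)
    (lamM lamS : ℝ)
    (hlamM : lamM = displacedIntensity 2 αM lamm wM vM)
    (hlamS : lamS = displacedIntensity 1 αS lams wS vS)
    -- MBSs in the plane; SBSs on the typical road (a line through the vehicle)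
    (Φ : Ω → Set (EuclideanSpace ℝ (Fin 2) × ℝ)) (Ξ : Ω → Set (ℝ × ℝ))
    (hΦ : IsShadowedPPP P Φ lamm wM vM) (hΞ : IsShadowedPPP P Ξ lams wS vS)
    (hindep : IndepPointProcesses P Φ Ξ)
    -- the distances to the nearest MBS and SBS, and the event of Case 2
    (XM XS : Ω → ℝ) (hXM : XM = nearestDist αM Φ) (hXS : XS = nearestDist αS Ξ)
    (C : Set Ω) (hC : C = case2 PM PS PV GM GS0 GV0 GV1 αM αS XM XS) :
    HasDensity XM P (pdfM lamM) ∧ HasDensity XS P (pdfS lamS) ∧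
    NullMeasurableSet C P ∧ 0 < P.real C ∧
    HasDensity XM P[|C] (fun x =>
      (Real.exp (-(2 * lamS * ASM ^ (1 / αS) * x ^ (αM / αS)))
        - Real.exp (-(2 * lamS * BSM ^ (1 / αS) * x ^ (αM / αS)))) * pdfM lamM x / P.real C) ∧
    HasDensity XS P[|C] (fun x =>
      (Real.exp (-(lamM * Real.pi * BMS ^ (2 / αM) * x ^ (2 * αS / αM)))
        - Real.exp (-(lamM * Real.pi * AMS ^ (2 / αM) * x ^ (2 * αS / αM)))) * pdfS lamS x
          / P.real C) := by
  have hlamM0 : 0 < lamM := hlamM ▸ displacedIntensity_pos hlamm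
  have hlamS0 : 0 < lamS := hlamS ▸ displacedIntensity_pos hlams
  have hcM : 0 < Real.pi * lamM := by positivity
  have hcS : 0 < 2 * lamS := by positivity
  have hkMd : 0 < PM * GM := by positivity
  have hkSd : 0 < PS * GS0 := by positivity
  have hkMu : 0 < PV * GV1 := by positivity
  have hkSu : 0 < PV * GV0 := by positivity
  have hBMS0 : 0 < BMS := by rw [hBMS]; positivity
  have hASM0 : 0 < ASM := by rw [hASM]; positivity
  have hAB' : ASM < BSM := by
    have := inv_strictAnti₀ hBMS0 hAB
    rwa [hAMS, hBMS, inv_div, inv_div, ← hASM, ← hBSM] at this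
  have hmM' : Measurable[pointSigma Φ] XM := hXM ▸ measurable_nearestDist_pointSigma αM Φ
  have hmS' : Measurable[pointSigma Ξ] XS := hXS ▸ measurable_nearestDist_pointSigma αS Ξ
  have hmM : Measurable XM := hmM'.mono hΦ.pointSigma_le le_rfl
  have hmS : Measurable XS := hmS'.mono hΞ.pointSigma_le le_rfl
  have hind : IndepFun XM XS P := by
    rw [IndepFun_iff_Indep]
    exact indep_of_indep_of_le_left (indep_of_indep_of_le_right hindep hmS'.comap_le) hmM'.comap_le
  have hXM0 : ∀ ω, 0 ≤ XM ω := fun ω => hXM ▸ Metric.infDist_nonneg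
  have hXS0 : ∀ ω, 0 ≤ XS ω := fun ω => hXS ▸ Metric.infDist_nonneg
  have hmapM : P.map XM =
      volume.withDensity fun x => ENNReal.ofReal (radialPDF (Real.pi * lamM) 2 x) := by
    refine map_eq_withDensity_radialPDF hmM hXM0 hcM two_ne_zero fun r hr => ?_
    rw [hXM, hlamM]
    refine hΦ.measure_le_nearestDist hlamm Real.pi_pos two_ne_zero (fun ρ hρ => ?_) hr
    rw [EuclideanSpace.volume_ball_fin_two, ← ENNReal.ofReal_pow hρ, mul_comm,
      ← ENNReal.ofReal_mul Real.pi_pos.le]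
  have hmapS : P.map XS =
      volume.withDensity fun x => ENNReal.ofReal (radialPDF (2 * lamS) 1 x) := by
    refine map_eq_withDensity_radialPDF hmS hXS0 hcS one_ne_zero fun r hr => ?_
    rw [hXS, hlamS]
    refine hΞ.measure_le_nearestDist hlams two_pos one_ne_zero (fun ρ hρ => ?_) hr
    rw [Real.volume_ball, pow_one]
  set R : Set (ℝ × ℝ) := {p | AssocMBS (PM * GM) αM p.1 (PS * GS0) αS p.2 ∧
    ¬ AssocMBS (PV * GV1) αM p.1 (PV * GV0) αS p.2}
  have hR : MeasurableSet R :=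
    (measurableSet_assocMBS _ _ _ _).inter (measurableSet_assocMBS _ _ _ _).compl
  have hCR : C = {ω | (XM ω, XS ω) ∈ R} := hC
  set gM : ℝ → ℝ := fun x => Real.exp (-(2 * lamS * ASM ^ (1 / αS) * x ^ (αM / αS)))
        - Real.exp (-(2 * lamS * BSM ^ (1 / αS) * x ^ (αM / αS))) with hgM
  set gS : ℝ → ℝ := fun x => Real.exp (-(lamM * Real.pi * BMS ^ (2 / αM) * x ^ (2 * αS / αM)))
        - Real.exp (-(lamM * Real.pi * AMS ^ (2 / αM) * x ^ (2 * αS / αM))) with hgS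
  have hgMm : Measurable gM := by fun_prop
  have hgSm : Measurable gS := by fun_prop
  have hgM0 : ∀ x, 0 ≤ x → 0 ≤ gM x := fun x hx => by
    simp only [hgM, sub_nonneg]
    gcongr
  have hgMpos : ∀ x, 0 < x → 0 < gM x := fun x hx => by
    simp only [hgM, sub_pos]
    gcongr
  have hgS0 : ∀ x, 0 ≤ x → 0 ≤ gS x := fun x hx => by
    simp only [hgS, sub_nonneg]
    gcongr
  have hsecM : ∀ x, 0 < x → P.map XS (Prod.mk x ⁻¹' R) = ENNReal.ofReal (gM x) := by
    intro x hx
    have hae : Prod.mk x ⁻¹' R =ᵐ[P.map XS]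
        Set.Ico (ASM ^ (1 / αS) * x ^ (αM / αS)) (BSM ^ (1 / αS) * x ^ (αM / αS)) := by
      rw [hmapS]
      -- Solving for `y` yields an interval open on the left and closed on the right; having no
      -- atoms, the law does not see the endpoints.
      refine Filter.EventuallyEq.trans ?_
        ((withDensity_absolutelyContinuous _ _).ae_eq Ico_ae_eq_Ioc.symm)
      filter_upwards [ae_withDensity_radialPDF_pos (2 * lamS) 1] with y hy
      refine propext ?_
      change AssocMBS _ _ x _ _ y ∧ ¬ AssocMBS _ _ x _ _ y ↔ _ < y ∧ y ≤ _
      rw [assocMBS_iff_lt_right hkMd hkSd hαS hx hy, assocMBS_iff_lt_right hkMu hkSu hαS hx hy,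
        not_lt, hASM, hBSM]
    rw [measure_congr hae, hmapS, withDensity_radialPDF_Ico hcS one_ne_zero (by positivity)
      (by gcongr)]
    simp only [hgM, pow_one, mul_assoc]
  -- The swap puts `XS` first, so the same conditioning lemma applies with the roles exchanged.
  have hsecS : ∀ y, 0 < y → P.map XM (Prod.mk y ⁻¹' (Prod.swap ⁻¹' R)) =
      ENNReal.ofReal (gS y) := by
    intro y hy
    have hae : Prod.mk y ⁻¹' (Prod.swap ⁻¹' R) =ᵐ[P.map XM]
        Set.Ico (BMS ^ (1 / αM) * y ^ (αS / αM)) (AMS ^ (1 / αM) * y ^ (αS / αM)) := by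
      rw [hmapM]
      filter_upwards [ae_withDensity_radialPDF_pos (Real.pi * lamM) 2] with x hx
      refine propext ?_
      change AssocMBS _ _ x _ _ y ∧ ¬ AssocMBS _ _ x _ _ y ↔ _ ≤ x ∧ x < _
      rw [assocMBS_iff_lt_left hkMd hkSd hαM hx hy, assocMBS_iff_lt_left hkMu hkSu hαM hx hy,
        not_lt, hAMS, hBMS, and_comm]
    have hsq : ∀ k : ℝ, 0 < k → Real.pi * lamM * (k ^ (1 / αM) * y ^ (αS / αM)) ^ 2 =
        lamM * Real.pi * k ^ (2 / αM) * y ^ (2 * αS / αM) := by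
      intro k hk
      rw [mul_pow, ← Real.rpow_mul_natCast hk.le, ← Real.rpow_mul_natCast hy.le,
        show 1 / αM * ((2 : ℕ) : ℝ) = 2 / αM by push_cast; ring,
        show αS / αM * ((2 : ℕ) : ℝ) = 2 * αS / αM by push_cast; ring]
      ring
    rw [measure_congr hae, hmapM, withDensity_radialPDF_Ico hcM two_ne_zero (by positivity)
      (by gcongr), hsq _ hBMS0, hsq _ (hBMS0.trans hAB)]
  have hC0 : 0 < P.real C := by
    rw [measureReal_def, ENNReal.toReal_pos_iff]
    refine ⟨?_, measure_lt_top _ _⟩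
    -- Taking all of `ℝ` as the test set writes the probability of Case 2 as the integral of `gM`
    -- times the density of `XM`, which is positive on `(0, ∞)`.
    have h := measure_preimage_inter_of_indepFun hmM hmS hind (measurable_radialPDF _ 2)
      (radialPDF_nonneg hcM.le 2) (fun x hx => radialPDF_of_neg hx) hmapM hR hsecM
      MeasurableSet.univ
    rw [Set.preimage_univ, Set.univ_inter, ← hCR, Measure.restrict_univ] at h
    rw [h, lintegral_pos_iff_support (hgMm.fun_mul (measurable_radialPDF _ 2)).ennreal_ofReal]
    have hpos : (0 : ℝ≥0∞) < volume (Set.Ioi (0 : ℝ)) := by simp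
    refine hpos.trans_le (measure_mono fun x hx => ?_)
    exact (ENNReal.ofReal_pos.2 (mul_pos (hgMpos x hx) (radialPDF_pos hcM two_ne_zero hx))).ne'
  rw [pdfM_eq_radialPDF, pdfS_eq_radialPDF]
  exact ⟨hasDensity_of_map_eq_withDensity hmM.aemeasurable (measurable_radialPDF _ _)
      (radialPDF_nonneg hcM.le _) hmapM,
    hasDensity_of_map_eq_withDensity hmS.aemeasurable (measurable_radialPDF _ _)
      (radialPDF_nonneg hcS.le _) hmapS,
    (hCR ▸ (hmM.prodMk hmS) hR : MeasurableSet C).nullMeasurableSet, hC0,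
    hasDensity_cond_of_indepFun hmM hmS hind (measurable_radialPDF _ _)
      (radialPDF_nonneg hcM.le _) (fun x hx => radialPDF_of_neg hx) hmapM hgMm hgM0 hR hsecM
      hCR hC0,
    hasDensity_cond_of_indepFun hmS hmM hind.symm (measurable_radialPDF _ _)
      (radialPDF_nonneg hcS.le _) (fun x hx => radialPDF_of_neg hx) hmapS hgSm hgS0
      (measurable_swap hR) hsecS hCR hC0⟩
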